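/- **Setting.** A dynamical code on $n$ qubits with $l$ rounds consists of commuting Hermitian Pauli generators $S_0$ of the round-$0$ stabilizer group and, for $1\le i\le l$, a list $M_i$ of commuting Hermitian Pauli operators measured in round $i$. For Pauli operators with binary vectors $[a,b]$, $[c,d]$ let $A\odot B = a\cdot d+b\cdot c \bmod 2$. Let $L_0$ be a Hermitian Pauli operator commuting with $S_0$. Generators and logical representative are updated for each measured operator $m$ by the usual rules. Stabilizers: if $\pm m\in\langle S\rangle$, $S$ is unchanged; otherwise, if some generators anticommute with $m$, one of them, $s_1$, is replaced by $m$ and every other anticommuting generator $s$ by $s\,s_1$; otherwise $m$ is added to $S$. Logical: $L$ is unchanged if it commutes with $m$, and $L\to L\,s_1$ if $m$ anticommutes with $L$ and with some generator in $S$. It is assumed that the logical is never measured out, i.e. every measured $m$ that anticommutes with the current $L$ anticommutes with some current generator. (A new generator may be recorded as $m$ or, with its outcome, as $O(m)\,m$; this changes the later operators only by signs.) Let $L_l$ be the representative after round $l$. **Theorem.** For every choice of the replaced generators there are $s_0\in\langle S_0\rangle$ and $m_i\in\langle M_i\rangle$ ($1\le i\le l-1$), given as products of elements of $S_0$ and of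 $M_i$, that do not depend on the states, errors or outcomes, such that, up to sign, $$L_l = L_0\cdot s_0\cdot \prod_{i=1}^{l-1} m_i ;$$ the sign is $+1$ if every new generator is recorded as $m$ and the product is taken in chronological order, and if each measured $m$ is recorded as $\varepsilon_m m$ with $\varepsilon_m=\pm1$, it is the product of the signs $\varepsilon_m$ over the factors $m\in M_i$ of the $m_i$. Suppose that the initial state is a joint eigenstate of $L_0$ and $S_0$ with eigenvalues $O(L_0)$ and $O(s)$, $s\in S_0$; that the measurements of the rounds $1,\dots,l$ are performed with outcomes $\pm1$ that occur with nonzero probability; and that a Pauli error $e_0$ occurs after initialization and a Pauli error $e_k$ after round $k$, $1\le k\le l$. Let $E_k=e_l\cdots e_{k+1}e_k$ be the net error from after round $k$ until the end, let $O(s_0)$ be the product of the initial eigenvalues of the factors of $s_0$ and $O(m_i)$ the product of the measured outcomes of the factors of $m_i$. Then the final state is an eigenstate of $L_l=L_0\cdot s_0\cdot m_1\cdots m_{l-1}$ with eigenvalue $$O(L_l)=O(L_0)\,(-1)^{L_0\odot E_0}\Bigl(\prod_{i=1}^{l-1}O(m_i)\Bigr)\,O(s_0)\,(-1)^{E_0\odot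 s_0}\,(-1)^{\sum_{k=1}^{l-1}E_k\odot m_k}.$$ -/

import Mathlib

open Complex Matrix

/-- An `n`-qubit Pauli operator `i ^ phase · ∏ⱼ Xⱼ ^ (x j) · Zⱼ ^ (z j)`. -/
@[ext]
structure Pauli (n : ℕ) where
  phase : ZMod 4
  x : Fin n → ZMod 2
  z : Fin n → ZMod 2

/-- An unnormalized pure state of `n` qubits, in the computational basis. -/
abbrev QState (n : ℕ) := (Fin n → Fin 2) → ℂ

namespace Pauli

variable {n : ℕ}

/-- The operator denoted by a label: `i ^ phase · ⨂ⱼ X ^ (x j) Z ^ (z j)` as a matrix on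
`(ℂ²)^{⊗ n}`. -/
noncomputable def toMatrix (p : Pauli n) : Matrix (Fin n → Fin 2) (Fin n → Fin 2) ℂ :=
  Matrix.of fun v w => I ^ p.phase.val *
    ∏ j, ((!![0, 1; 1, 0] : Matrix (Fin 2) (Fin 2) ℂ) ^ (p.x j).val *
      (!![1, 0; 0, -1] : Matrix (Fin 2) (Fin 2) ℂ) ^ (p.z j).val) (v j) (w j)

/-- The exponent of `i` in `(-1) ^ a`, for a bit `a`. -/
def signPhase : ZMod 2 →+ ZMod 4 where
  toFun a := 2 * (a.val : ZMod 4)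
  map_zero' := by decide
  map_add' := by decide

/-- Operator product; moving `Z ^ z` past `X ^ x'` costs the sign `(-1) ^ (z · x')`.
See `toMatrix_mul`. -/
instance : Mul (Pauli n) :=
  ⟨fun p q => ⟨p.phase + q.phase + signPhase (p.z ⬝ᵥ q.x), p.x + q.x, p.z + q.z⟩⟩

instance : One (Pauli n) := ⟨⟨0, 0, 0⟩⟩

instance : Inv (Pauli n) := ⟨fun p => ⟨-p.phase - signPhase (p.z ⬝ᵥ p.x), p.x, p.z⟩⟩

theorem mul_def (p q : Pauli n) :
    p * q = ⟨p.phase + q.phase + signPhase (p.z ⬝ᵥ q.x), p.x + q.x, p.z + q.z⟩ := rfl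

theorem one_def : (1 : Pauli n) = ⟨0, 0, 0⟩ := rfl

theorem inv_def (p : Pauli n) :
    p⁻¹ = ⟨-p.phase - signPhase (p.z ⬝ᵥ p.x), p.x, p.z⟩ := rfl

instance : Group (Pauli n) :=
  Group.ofLeftAxioms
    (by
      intro a b c
      simp only [mul_def, dotProduct_add, add_dotProduct, map_add, add_assoc]
      congr 1
      ring)
    (by intro a; simp [mul_def, one_def])
    (by
      intro a
      have h : ∀ y : Fin n → ZMod 2, y + y = 0 := fun y => by
        funext j; exact CharTwo.add_self_eq_zero (y j)
      simp only [mul_def, one_def, inv_def, h, sub_add, Pauli.mk.injEq, and_true]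
      ring)

/-- The group law on labels is the product of operators. -/
theorem toMatrix_mul (p q : Pauli n) : (p * q).toMatrix = p.toMatrix * q.toMatrix := by
  have hI : ∀ a b : ZMod 4, I ^ (a + b).val = I ^ a.val * I ^ b.val := by
    intro a b
    rw [ZMod.val_add, ← pow_add]
    conv_rhs => rw [← Nat.mod_add_div (a.val + b.val) 4, pow_add, pow_mul, I_pow_four, one_pow,
      mul_one]
  have hs : ∀ a : ZMod 2, I ^ (signPhase a).val = (-1 : ℂ) ^ a.val := by
    intro a
    rcases (by decide : ∀ a : ZMod 2, a = 0 ∨ a = 1) a with rfl | rfl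
    · simp
    · have : (signPhase (1 : ZMod 2)).val = 2 := by decide
      change I ^ (signPhase (1 : ZMod 2)).val = (-1 : ℂ) ^ (1 : ZMod 2).val
      rw [this]; simp [ZMod.val_one]
  have hadd : ∀ a b : ZMod 2, (-1 : ℂ) ^ (a + b).val = (-1) ^ a.val * (-1) ^ b.val := by
    intro a b
    rw [← hs, ← hs, ← hs, map_add, hI]
  have hsum : ∀ (s : Finset (Fin n)) (f : Fin n → ZMod 2),
      (-1 : ℂ) ^ (∑ j ∈ s, f j).val = ∏ j ∈ s, (-1 : ℂ) ^ (f j).val := by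
    intro s f
    induction s using Finset.induction_on with
    | empty => simp
    | insert a s ha ih => rw [Finset.sum_insert ha, Finset.prod_insert ha, hadd, ih]
  have hone : ∀ a b c d : ZMod 2,
      (-1 : ℂ) ^ (b * c).val • ((!![0, 1; 1, 0] : Matrix (Fin 2) (Fin 2) ℂ) ^ (a + c).val *
        (!![1, 0; 0, -1] : Matrix (Fin 2) (Fin 2) ℂ) ^ (b + d).val) =
      ((!![0, 1; 1, 0] : Matrix (Fin 2) (Fin 2) ℂ) ^ a.val *
        (!![1, 0; 0, -1] : Matrix (Fin 2) (Fin 2) ℂ) ^ b.val) *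
      ((!![0, 1; 1, 0] : Matrix (Fin 2) (Fin 2) ℂ) ^ c.val *
        (!![1, 0; 0, -1] : Matrix (Fin 2) (Fin 2) ℂ) ^ d.val) := by
    have hv : (1 : ZMod 2).val = 1 := rfl
    have h11 : (1 + 1 : ZMod 2) = 0 := by decide
    have hcase : ∀ a : ZMod 2, a = 0 ∨ a = 1 := by decide
    intro a b c d
    rcases hcase a with rfl | rfl <;> rcases hcase b with rfl | rfl <;>
      rcases hcase c with rfl | rfl <;> rcases hcase d with rfl | rfl <;>
      ext i j <;> fin_cases i <;> fin_cases j <;>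
      simp [hv, h11, Matrix.mul_apply, Fin.sum_univ_two]
  ext v w
  simp only [toMatrix, Matrix.of_apply, Matrix.mul_apply, mul_def, hI, hs, dotProduct, hsum]
  have hstep : ∀ u : Fin n → Fin 2,
      (I ^ p.phase.val * ∏ j, ((!![0, 1; 1, 0] : Matrix (Fin 2) (Fin 2) ℂ) ^ (p.x j).val *
          (!![1, 0; 0, -1] : Matrix (Fin 2) (Fin 2) ℂ) ^ (p.z j).val) (v j) (u j)) *
        (I ^ q.phase.val * ∏ j, ((!![0, 1; 1, 0] : Matrix (Fin 2) (Fin 2) ℂ) ^ (q.x j).val *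
          (!![1, 0; 0, -1] : Matrix (Fin 2) (Fin 2) ℂ) ^ (q.z j).val) (u j) (w j)) =
      (I ^ p.phase.val * I ^ q.phase.val) *
        ∏ j, (((!![0, 1; 1, 0] : Matrix (Fin 2) (Fin 2) ℂ) ^ (p.x j).val *
          (!![1, 0; 0, -1] : Matrix (Fin 2) (Fin 2) ℂ) ^ (p.z j).val) (v j) (u j) *
          ((!![0, 1; 1, 0] : Matrix (Fin 2) (Fin 2) ℂ) ^ (q.x j).val *
          (!![1, 0; 0, -1] : Matrix (Fin 2) (Fin 2) ℂ) ^ (q.z j).val) (u j) (w j)) := by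
    intro u
    rw [Finset.prod_mul_distrib]
    ring
  simp only [← Matrix.mul_apply] at hstep ⊢
  rw [Finset.sum_congr rfl fun u _ => hstep u, ← Finset.mul_sum, mul_assoc,
    ← Finset.prod_mul_distrib]
  congr 1
  have hprod := Fintype.prod_sum (R := ℂ) fun (j : Fin n) (b : Fin 2) =>
      ((!![0, 1; 1, 0] : Matrix (Fin 2) (Fin 2) ℂ) ^ (p.x j).val *
          (!![1, 0; 0, -1] : Matrix (Fin 2) (Fin 2) ℂ) ^ (p.z j).val) (v j) b *
          ((!![0, 1; 1, 0] : Matrix (Fin 2) (Fin 2) ℂ) ^ (q.x j).val *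
          (!![1, 0; 0, -1] : Matrix (Fin 2) (Fin 2) ℂ) ^ (q.z j).val) b (w j)
  rw [← hprod]
  refine Finset.prod_congr rfl fun j _ => ?_
  rw [← Matrix.mul_apply, ← hone]
  simp

/-- The symplectic inner product `A ⊙ B` of the binary vectors of two Pauli operators. -/
def symp (A B : Pauli n) : ZMod 2 := A.x ⬝ᵥ B.z + A.z ⬝ᵥ B.x

/-- The scalar operator `±1`. -/
def ofSign (ε : ℤˣ) : Pauli n := ⟨if ε = 1 then 0 else 2, 0, 0⟩

/-- Pauli operators that can be measured with outcomes `±1`. A Pauli operator is unitary, so it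
is Hermitian iff its square is `1`; this excludes the phases `±i`. -/
def IsObservable (p : Pauli n) : Prop := p * p = 1

/-- The product of the `g j` with `j ∈ A`. For commuting observables `g j` these products are
exactly the elements of the group generated by the `g j`. -/
def subsetProd {r : ℕ} (g : Fin r → Pauli n) (A : Finset (Fin r)) : Pauli n :=
  (List.ofFn fun j => if j ∈ A then g j else 1).prod

theorem subsetProd_mem_closure {r : ℕ} (g : Fin r → Pauli n) (A : Finset (Fin r)) :
    subsetProd g A ∈ Subgroup.closure (Set.range g) := by
  refine list_prod_mem fun y hy => ?_
  obtain ⟨j, rfl⟩ := (List.mem_ofFn' _ _).1 hy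
  dsimp only
  split_ifs
  · exact Subgroup.subset_closure ⟨j, rfl⟩
  · exact one_mem _

/-- The state `ψ` has the definite outcome `v ∈ {±1}` for `p`: measuring `p` on `ψ` returns `v`
with certainty. -/
def HasOutcome (p : Pauli n) (v : ℤˣ) (ψ : QState n) : Prop :=
  ψ ≠ 0 ∧ p.toMatrix *ᵥ ψ = ((v : ℤ) : ℂ) • ψ

/-- The (unnormalized) state after the projective measurement of the observable `m` on `ψ` has
returned `v`: the projector `(1 + v · m) / 2` is applied. -/
noncomputable def measure (m : Pauli n) (v : ℤˣ) (ψ : QState n) : QState n :=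
  (1 / 2 : ℂ) • (ψ + ((v : ℤ) : ℂ) • (m.toMatrix *ᵥ ψ))

end Pauli

/-- A dynamical code with `l` rounds of measurements on `n` qubits: commuting generators of the
stabilizer group of round `0`, and for each round `k = 1, …, l` commuting Pauli observables,
listed in some order (`meas k` is not used for other values of `k`). -/
structure DynamicalCode (n l : ℕ) where
  numStab : ℕ
  stab : Fin numStab → Pauli n
  stab_observable : ∀ j, (stab j).IsObservable
  stab_commute : ∀ i j, Commute (stab i) (stab j)
  numMeas : ℕ → ℕ
  meas : (k : ℕ) → Fin (numMeas k) → Pauli n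
  meas_observable : ∀ k, 1 ≤ k → k ≤ l → ∀ j, (meas k j).IsObservable
  meas_commute : ∀ k, 1 ≤ k → k ≤ l → ∀ i j, Commute (meas k i) (meas k j)

/-- The generators of an instantaneous stabilizer group and a representative of the logical
operator. -/
structure Tracked (n : ℕ) where
  gens : List (Pauli n)
  logical : Pauli n

namespace Tracked

variable {n : ℕ}

/-- Some current generator anticommutes with `m` (Pauli operators that do not commute
anticommute). -/
def Disturbs (m : Pauli n) (T : Tracked n) : Prop := ∃ s ∈ T.gens, ¬ Commute s m

open Classical in
/-- The stabilizer update rules for measuring `m`, where `ε · m` is the operator that is recorded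
as a new generator and `p` is the position of the generator `s₁` that is replaced, if there is
one. -/
noncomputable def updateGens (m : Pauli n) (ε : ℤˣ) (p : ℕ) (T : Tracked n) : List (Pauli n) :=
  if ∃ η : ℤˣ, Pauli.ofSign η * m ∈ Subgroup.closure {s | s ∈ T.gens} then T.gens
  else if T.Disturbs m then
    (T.gens.map fun s => if Commute s m then s else s * T.gens.getD p 1).set p
      (Pauli.ofSign ε * m)
  else T.gens ++ [Pauli.ofSign ε * m]

open Classical in
/-- The logical update rules for measuring `m`. -/
noncomputable def updateLogical (m : Pauli n) (ε : ℤˣ) (p : ℕ) (T : Tracked n) : Pauli n :=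
  if Commute m T.logical then T.logical
  else if T.Disturbs m then T.logical * T.gens.getD p 1
  else Pauli.ofSign ε * m

noncomputable def update (m : Pauli n) (ε : ℤˣ) (p : ℕ) (T : Tracked n) : Tracked n :=
  ⟨T.updateGens m ε p, T.updateLogical m ε p⟩

end Tracked

namespace DynamicalCode

variable {n l : ℕ} (C : DynamicalCode n l)

/-- A sign for every measurement, for instance its outcome. -/
abbrev Signs := (k : ℕ) → Fin (C.numMeas k) → ℤˣ

/-- For every measurement a position in the list of current generators. -/
abbrev Pivots := (k : ℕ) → Fin (C.numMeas k) → ℕ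

/-- Update `T` with the first `j` measurements of round `k`. -/
noncomputable def trackPartial (p : C.Pivots) (ε : C.Signs) (k : ℕ) (T : Tracked n) (j : ℕ) :
    Tracked n :=
  ((List.finRange (C.numMeas k)).take j).foldl
    (fun T' i => T'.update (C.meas k i) (ε k i) (p k i)) T

/-- The generators of the instantaneous stabilizer group and the logical representative after
round `k`, where the measurement `m = C.meas k j` is recorded as `ε k j · m`. -/
noncomputable def track (L₀ : Pauli n) (p : C.Pivots) (ε : C.Signs) : ℕ → Tracked n
  | 0 => ⟨List.ofFn C.stab, L₀⟩
  | k + 1 => C.trackPartial p ε (k + 1) (track L₀ p ε k) (C.numMeas (k + 1))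

/-- What is tracked immediately before the measurement `C.meas (k + 1) j`. -/
noncomputable def before (L₀ : Pauli n) (p : C.Pivots) (ε : C.Signs) (k : ℕ)
    (j : Fin (C.numMeas (k + 1))) : Tracked n :=
  C.trackPartial p ε (k + 1) (C.track L₀ p ε k) j

/-- Whenever a measurement anticommutes with some current generator, the pivot is the position of
such a generator. -/
def ValidPivots (L₀ : Pauli n) (p : C.Pivots) (ε : C.Signs) : Prop :=
  ∀ k < l, ∀ j : Fin (C.numMeas (k + 1)),
    (C.before L₀ p ε k j).Disturbs (C.meas (k + 1) j) →
      ∃ h : p (k + 1) j < (C.before L₀ p ε k j).gens.length,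
        ¬ Commute ((C.before L₀ p ε k j).gens[p (k + 1) j]) (C.meas (k + 1) j)

/-- The logical information is never measured out: a measurement that anticommutes with the
current logical representative anticommutes with some current stabilizer generator. -/
def PreservesLogical (L₀ : Pauli n) (p : C.Pivots) (ε : C.Signs) : Prop :=
  ∀ k < l, ∀ j : Fin (C.numMeas (k + 1)),
    ¬ Commute (C.meas (k + 1) j) (C.before L₀ p ε k j).logical →
      (C.before L₀ p ε k j).Disturbs (C.meas (k + 1) j)

/-- The (unnormalized) state after round `k` of measurements with outcomes `o` and the error `e k`
that follows it, for the initial state `ψ`; the error `e 0` occurs between initialization and the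
first round. -/
noncomputable def stateAfter (o : C.Signs) (e : ℕ → Pauli n) (ψ : QState n) : ℕ → QState n
  | 0 => (e 0).toMatrix *ᵥ ψ
  | k + 1 => (e (k + 1)).toMatrix *ᵥ
      (List.finRange (C.numMeas (k + 1))).foldl
        (fun φ j => (C.meas (k + 1) j).measure (o (k + 1) j) φ) (stateAfter o e ψ k)

end DynamicalCode

/-- The net error `E_k = e_l ⋯ e_{k+1} e_k` from after round `k` until the end of an `l`-round
code. -/
def netError {n : ℕ} (l : ℕ) (e : ℕ → Pauli n) (k : ℕ) : Pauli n :=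
  ((List.range' k (l + 1 - k)).map e).reverse.prod

/-! Every tracked operator is $L_0$ or $1$ times a product of initial generators and measured
operators. A `Label` records which factors occur, modulo two. Signs affect neither commutation nor
membership in the stabilizer group up to sign, so the update rules act on labels alone, and one
label serves all outcomes and errors.

Products of such words must be brought back to chronological order without a sign. This is what
`Adapted` is for: an operator kept through a round without being replaced commutes at its end with
all measurements of that round. So the part of a word up to round $k$ commutes with the measurements
of round $k+1$, a property inherited by products. By `Label.word_mul` the factors of two such words
then interleave freely, and repeated factors cancel because observables square to $1$.

A replaced generator $s_1$ anticommutes with the measured $m$, whereas operators of one round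
commute. Hence $s_1$ was not newly measured in the current round, and the logical only acquires
factors of earlier rounds; this is why round $l$ is absent. The single-measurement step is
`IsNamed.update`.

For eigenvalues, `Label.char` multiplies the values of the factors and is multiplicative on labels.
A commuting measurement preserves a value, a measured operator takes its outcome, and an error $e$
flips a word $W$ by $(-1)^{e\odot W}$. As $\odot$ is additive, the flip can be charged to the
factors separately, and a factor from round $k$ accumulates exactly $E_k$ (`char_values_succ`). -/

namespace Pauli

variable {n : ℕ}

/-! ### Commutation and signs of Pauli operators -/

theorem symp_comm (a b : Pauli n) : symp a b = symp b a := by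
  simp only [symp]
  rw [dotProduct_comm a.x b.z, dotProduct_comm a.z b.x, add_comm]

theorem symp_mul_left (a b c : Pauli n) : symp (a * b) c = symp a c + symp b c := by
  simp only [symp, mul_def, add_dotProduct]; ring

theorem symp_mul_right (a b c : Pauli n) : symp a (b * c) = symp a b + symp a c := by
  rw [symp_comm, symp_mul_left, symp_comm b, symp_comm c]

@[simp] theorem symp_one_left (a : Pauli n) : symp 1 a = 0 := by simp [symp, one_def]

@[simp] theorem symp_one_right (a : Pauli n) : symp a 1 = 0 := by simp [symp, one_def]

@[simp] theorem symp_ofSign_left (ε : ℤˣ) (a : Pauli n) : symp (ofSign ε) a = 0 := by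
  simp [symp, ofSign]

theorem ofSign_one : (ofSign 1 : Pauli n) = 1 := by simp [ofSign, one_def]

theorem ofSign_mul (a b : ℤˣ) : (ofSign (a * b) : Pauli n) = ofSign a * ofSign b := by
  have h4 : (2 + 2 : ZMod 4) = 0 := by decide
  rcases Int.units_eq_one_or a with rfl | rfl <;> rcases Int.units_eq_one_or b with rfl | rfl <;>
    simp [ofSign, mul_def, h4]

/-- The two orders differ only in the phase terms `a.z ⬝ᵥ b.x` and `b.z ⬝ᵥ a.x`, whose sum modulo
two is the symplectic product. -/
theorem mul_comm_sign (a b : Pauli n) : a * b = ofSign ((-1) ^ symp a b) * (b * a) := by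
  have key : ∀ u v : ZMod 2, signPhase u =
      (if ((-1 : ℤˣ) ^ (v + u) = 1) then (0 : ZMod 4) else 2) + signPhase v := by
    decide
  ext1
  · have hs : symp a b = b.z ⬝ᵥ a.x + a.z ⬝ᵥ b.x := by rw [symp, dotProduct_comm a.x b.z]
    simp only [mul_def, ofSign, zero_dotProduct, map_zero, add_zero]
    rw [key (a.z ⬝ᵥ b.x) (b.z ⬝ᵥ a.x), ← hs]
    ring
  · simp [mul_def, ofSign, add_comm]
  · simp [mul_def, ofSign, add_comm]

theorem ofSign_ne_one : (ofSign (-1) : Pauli n) ≠ 1 := by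
  intro h
  have := congrArg Pauli.phase h
  simp [ofSign, one_def] at this
  revert this
  decide

theorem commute_iff (a b : Pauli n) : Commute a b ↔ symp a b = 0 := by
  constructor
  · intro h
    by_contra hne
    have h1 : symp a b = 1 := (by decide : ∀ u : ZMod 2, u ≠ 0 → u = 1) _ hne
    have := mul_comm_sign a b
    rw [h.eq, h1, uzpow_one] at this
    exact ofSign_ne_one (right_eq_mul.1 this)
  · intro h
    have := mul_comm_sign a b
    rwa [h, uzpow_zero, ofSign_one, one_mul] at this

theorem symp_eq_one_of_not_commute {a b : Pauli n} (h : ¬ Commute a b) : symp a b = 1 := by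
  rw [commute_iff] at h
  exact (by decide : ∀ u : ZMod 2, u ≠ 0 → u = 1) _ h

theorem commute_mul_of_not_commute {a b m : Pauli n} (ha : ¬ Commute a m) (hb : ¬ Commute b m) :
    Commute (a * b) m := by
  rw [commute_iff, symp_mul_left, symp_eq_one_of_not_commute ha, symp_eq_one_of_not_commute hb]
  decide

theorem ofSign_commute (ε : ℤˣ) (a : Pauli n) : Commute (ofSign ε) a := by
  simp [commute_iff]

theorem commute_ofSign_mul_left (ε : ℤˣ) (a b : Pauli n) :
    Commute (ofSign ε * a) b ↔ Commute a b := by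
  simp [commute_iff, symp_mul_left]

theorem symp_list_prod (a : Pauli n) (L : List (Pauli n)) :
    symp a L.prod = (L.map (symp a)).sum := by
  induction L with
  | nil => simp
  | cons b L ih => simp [symp_mul_right, ih]

theorem neg_one_uzpow_sum {ι : Type*} (s : Finset ι) (f : ι → ZMod 2) :
    (-1 : ℤˣ) ^ (∑ i ∈ s, f i) = ∏ i ∈ s, (-1 : ℤˣ) ^ f i := by
  classical
  induction s using Finset.induction_on with
  | empty => simp
  | insert a s ha ih => rw [Finset.sum_insert ha, Finset.prod_insert ha, uzpow_add, ih]

/-- Signs are central and form a group, so they can be collected in front of any word in the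
generators. -/
theorem ofSign_mul_mem_closure {S S' : Set (Pauli n)}
    (h : ∀ s ∈ S, ∃ η : ℤˣ, ofSign η * s ∈ Subgroup.closure S') {x : Pauli n}
    (hx : x ∈ Subgroup.closure S) : ∃ η : ℤˣ, ofSign η * x ∈ Subgroup.closure S' := by
  induction hx using Subgroup.closure_induction with
  | mem x hx => exact h x hx
  | one => exact ⟨1, by simp [ofSign_one, one_mem]⟩
  | mul x y _ _ hx hy =>
    obtain ⟨a, ha⟩ := hx
    obtain ⟨b, hb⟩ := hy
    refine ⟨a * b, ?_⟩
    have := mul_mem ha hb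
    rwa [mul_assoc, ← mul_assoc x, ← (ofSign_commute b x).eq, mul_assoc, ← mul_assoc,
      ← ofSign_mul] at this
  | inv x _ hx =>
    obtain ⟨a, ha⟩ := hx
    refine ⟨a, ?_⟩
    have h1 : (ofSign a : Pauli n)⁻¹ = ofSign a := by
      rw [inv_eq_iff_mul_eq_one, ← ofSign_mul, Int.units_mul_self, ofSign_one]
    have := inv_mem ha
    rwa [_root_.mul_inv_rev, h1, ← (ofSign_commute a _).eq] at this

/-! ### Subset products -/

theorem prod_ofFn_mul {M : Type*} [Monoid M] {r : ℕ} (f g : Fin r → M)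
    (h : ∀ i j, Commute (f i) (g j)) :
    (List.ofFn f).prod * (List.ofFn g).prod = (List.ofFn fun j => f j * g j).prod := by
  induction r with
  | zero => simp
  | succ r ih =>
    simp only [List.ofFn_succ, List.prod_cons]
    rw [← ih (fun i => f i.succ) (fun i => g i.succ) fun i j => h _ _]
    have : Commute (List.ofFn fun i : Fin r => f i.succ).prod (g 0) := by
      refine Commute.list_prod_left _ _ fun x hx => ?_
      obtain ⟨j, rfl⟩ := (List.mem_ofFn' _ _).1 hx
      exact h _ _
    rw [mul_assoc, ← mul_assoc _ (g 0), this.eq]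
    simp only [mul_assoc]

theorem prod_ofFn_ite_eq {M : Type*} [Monoid M] {r : ℕ} (f : Fin r → M) (j : Fin r) :
    (List.ofFn fun i => if i = j then f i else 1).prod = f j := by
  induction r with
  | zero => exact j.elim0
  | succ r ih =>
    rw [List.ofFn_succ, List.prod_cons]
    refine Fin.cases ?_ (fun j => ?_) j
    · simp [Fin.succ_ne_zero]
    · simp only [Fin.succ_inj, (Fin.succ_ne_zero j).symm, if_false, one_mul]
      exact ih (fun i => f i.succ) j

@[simp] theorem subsetProd_empty {r : ℕ} (g : Fin r → Pauli n) : subsetProd g ∅ = 1 := by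
  simp [subsetProd]

@[simp] theorem subsetProd_singleton {r : ℕ} (g : Fin r → Pauli n) (j : Fin r) :
    subsetProd g {j} = g j := by
  simpa [subsetProd] using prod_ofFn_ite_eq g j

/-- Commuting factors can be paired index by index, and a factor chosen twice squares to $1$. -/
theorem subsetProd_mul {r : ℕ} {g : Fin r → Pauli n} (hc : ∀ i j, Commute (g i) (g j))
    (ho : ∀ j, (g j).IsObservable) (A B : Finset (Fin r)) :
    subsetProd g A * subsetProd g B = subsetProd g (symmDiff A B) := by
  unfold subsetProd
  rw [prod_ofFn_mul]
  · congr 2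
    funext j
    have := ho j
    simp only [IsObservable] at this
    by_cases hA : j ∈ A <;> by_cases hB : j ∈ B <;> simp [Finset.mem_symmDiff, hA, hB, this]
  · intro i j
    split_ifs <;> simp [hc]

theorem commute_subsetProd {r : ℕ} {g : Fin r → Pauli n} {x : Pauli n}
    (h : ∀ j, Commute x (g j)) (A : Finset (Fin r)) : Commute x (subsetProd g A) := by
  refine Commute.list_prod_right _ _ fun y hy => ?_
  obtain ⟨j, rfl⟩ := (List.mem_ofFn' _ _).1 hy
  dsimp only
  split_ifs <;> simp [h]

theorem symp_subsetProd {r : ℕ} (a : Pauli n) (g : Fin r → Pauli n) (A : Finset (Fin r)) :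
    symp a (subsetProd g A) = ∑ j ∈ A, symp a (g j) := by
  rw [subsetProd, symp_list_prod, List.map_ofFn, List.sum_ofFn]
  simp [apply_ite (symp a)]

/-! ### Eigenvalues -/

theorem toMatrix_ofSign (ε : ℤˣ) :
    (ofSign ε : Pauli n).toMatrix = ((ε : ℤ) : ℂ) • (1 : Matrix (Fin n → Fin 2) _ ℂ) := by
  have h2 : (2 : ZMod 4).val = 2 := by decide
  have h0 : ∀ v w : Fin n → Fin 2, (∏ j, (1 : Matrix (Fin 2) (Fin 2) ℂ) (v j) (w j)) =
      (1 : Matrix (Fin n → Fin 2) _ ℂ) v w := by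
    intro v w
    by_cases h : v = w
    · subst h; simp
    · obtain ⟨j, hj⟩ := Function.ne_iff.1 h
      rw [Matrix.one_apply_ne h]
      exact Finset.prod_eq_zero (Finset.mem_univ j) (Matrix.one_apply_ne hj)
  ext v w
  rcases Int.units_eq_one_or ε with rfl | rfl <;> simp [toMatrix, ofSign, h0, h2]

/-- `ψ` is zero or an eigenvector of `p` with eigenvalue `v`. -/
def Fixes (p : Pauli n) (v : ℤˣ) (ψ : QState n) : Prop :=
  p.toMatrix *ᵥ ψ = ((v : ℤ) : ℂ) • ψ

theorem Fixes.mul {p q : Pauli n} {v w : ℤˣ} {ψ : QState n} (hp : Fixes p v ψ)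
    (hq : Fixes q w ψ) : Fixes (p * q) (v * w) ψ := by
  unfold Fixes at *
  rw [toMatrix_mul, ← mulVec_mulVec, hq, mulVec_smul, hp, smul_smul]
  congr 1
  push_cast
  ring

theorem Fixes.error {p : Pauli n} {v : ℤˣ} {ψ : QState n} (hp : Fixes p v ψ) (e : Pauli n) :
    Fixes p (v * (-1) ^ symp e p) (e.toMatrix *ᵥ ψ) := by
  unfold Fixes at *
  rw [mulVec_mulVec, ← toMatrix_mul, mul_comm_sign, toMatrix_mul, toMatrix_mul, toMatrix_ofSign,
    symp_comm, ← mulVec_mulVec, ← mulVec_mulVec, hp, smul_mulVec, one_mulVec, mulVec_smul,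
    smul_smul]
  congr 1
  push_cast
  ring

/-- The projector $(1+om)/2$ commutes with $p$. -/
theorem Fixes.measure {p m : Pauli n} {v : ℤˣ} {ψ : QState n} (hp : Fixes p v ψ)
    (hpm : Commute p m) (o : ℤˣ) : Fixes p v (m.measure o ψ) := by
  unfold Fixes Pauli.measure at *
  have : p.toMatrix *ᵥ (m.toMatrix *ᵥ ψ) = ((v : ℤ) : ℂ) • (m.toMatrix *ᵥ ψ) := by
    rw [mulVec_mulVec, ← toMatrix_mul, hpm.eq, toMatrix_mul, ← mulVec_mulVec, hp, mulVec_smul]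
  rw [mulVec_smul, mulVec_add, mulVec_smul, this, hp]
  module

/-- From $m^2=1$ and $o^2=1$ follows $m(1+om)=o(1+om)$. -/
theorem fixes_measure_self {m : Pauli n} (hm : m.IsObservable) (o : ℤˣ) (ψ : QState n) :
    Fixes m o (m.measure o ψ) := by
  unfold Fixes Pauli.measure
  have h1 : m.toMatrix *ᵥ (m.toMatrix *ᵥ ψ) = ψ := by
    rw [mulVec_mulVec, ← toMatrix_mul, hm, ← ofSign_one, toMatrix_ofSign]
    simp
  rw [mulVec_smul, mulVec_add, mulVec_smul, h1]
  rcases Int.units_eq_one_or o with rfl | rfl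
  · simp [add_comm]
  · simp only [Units.val_neg, Units.val_one, Int.cast_neg, Int.cast_one]
    module

end Pauli

/-! ### Labels and their chronological words -/

namespace DynamicalCode

variable {n l : ℕ} (C : DynamicalCode n l)

/-- A choice of initial generators and of measurements in every round, naming the factors of a
tracked operator. -/
structure Label where
  stab : Finset (Fin C.numStab)
  meas : (k : ℕ) → Finset (Fin (C.numMeas k))

namespace Label

variable {C}

/-- Chosen factors are counted modulo two. -/
instance : Mul C.Label :=
  ⟨fun A B => ⟨symmDiff A.stab B.stab, fun k => symmDiff (A.meas k) (B.meas k)⟩⟩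

theorem mul_def (A B : C.Label) :
    A * B = ⟨symmDiff A.stab B.stab, fun k => symmDiff (A.meas k) (B.meas k)⟩ := rfl

variable (C) in
/-- The label of the measurement `C.meas k j`. -/
def single (k : ℕ) (j : Fin (C.numMeas k)) : C.Label := ⟨∅, Function.update (fun _ => ∅) k {j}⟩

/-- The operator `B` times the factors named by `A` up to round `N`, in chronological order. -/
def word (B : Pauli n) (A : C.Label) (N : ℕ) : Pauli n :=
  B * Pauli.subsetProd C.stab A.stab *
    ((List.range' 1 N).map fun k => Pauli.subsetProd (C.meas k) (A.meas k)).prod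

/-- The product of the values of the factors named by `A`. -/
def char (f₀ : Fin C.numStab → ℤˣ) (f : C.Signs) (A : C.Label) : ℤˣ :=
  (∏ j ∈ A.stab, f₀ j) * ∏ k ∈ Finset.Icc 1 l, ∏ j ∈ A.meas k, f k j

/-- The operator named by `A` when the measurements `m` are recorded as `ε · m`. -/
def signedWord (ε : C.Signs) (B : Pauli n) (A : C.Label) : Pauli n :=
  Pauli.ofSign (char (fun _ => 1) ε A) * word B A l

/-- `A` names no factor of a round after `K`, its truncations commute with the measurements of the
rounds that follow them up to round `K`, and the whole operator commutes with the first `j`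
measurements of round `K + 1`. -/
structure Adapted (B : Pauli n) (A : C.Label) (K j : ℕ) : Prop where
  meas_eq_empty : ∀ k, K < k → A.meas k = ∅
  commute_trunc : ∀ k < K, ∀ i, Commute (word B A k) (C.meas (k + 1) i)
  commute_word : ∀ i : Fin (C.numMeas (K + 1)), (i : ℕ) < j →
    Commute (word B A l) (C.meas (K + 1) i)

@[simp] theorem word_zero (B : Pauli n) (A : C.Label) :
    word B A 0 = B * Pauli.subsetProd C.stab A.stab := by
  simp [word]

theorem word_succ (B : Pauli n) (A : C.Label) (N : ℕ) :
    word B A (N + 1) = word B A N * Pauli.subsetProd (C.meas (N + 1)) (A.meas (N + 1)) := by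
  simp only [word, List.range'_concat, List.map_append, List.prod_append, List.map_cons,
    List.map_nil, List.prod_singleton, one_mul, mul_assoc, add_comm 1 N]

theorem word_eq_of_meas_eq_empty {B : Pauli n} {A : C.Label} {K N : ℕ}
    (h : ∀ k, K < k → A.meas k = ∅) (hN : K ≤ N) : word B A N = word B A K := by
  induction N, hN using Nat.le_induction with
  | base => rfl
  | succ N hN ih => rw [word_succ, h _ (by omega), Pauli.subsetProd_empty, mul_one, ih]

/-- No sign appears: the factors of `A` from each round only have to pass the part of `P` from
earlier rounds, which commutes with them by `hP`. Only the right-hand word needs this condition. -/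
theorem word_mul {B : Pauli n} {A P : C.Label} {K N : ℕ} (hK : K ≤ l) (hN : N ≤ K)
    (hP : ∀ k < K, ∀ i, Commute (word 1 P k) (C.meas (k + 1) i)) :
    word B A N * word 1 P N = word B (A * P) N := by
  induction N with
  | zero =>
    simp only [word_zero, one_mul, mul_assoc, mul_def]
    rw [Pauli.subsetProd_mul C.stab_commute C.stab_observable]
  | succ N ih =>
    have hc := Pauli.commute_subsetProd (hP N (by omega)) (A.meas (N + 1))
    rw [word_succ, word_succ, word_succ, ← ih (by omega), mul_assoc, ← mul_assoc _ (word 1 P N),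
      ← hc.eq, mul_assoc, Pauli.subsetProd_mul (C.meas_commute _ (by omega) (by omega))
        (C.meas_observable _ (by omega) (by omega)), mul_assoc]
    rfl

theorem mul_meas_eq_empty {A P : C.Label} {K : ℕ} (hA : ∀ k, K < k → A.meas k = ∅)
    (hP : ∀ k, K < k → P.meas k = ∅) (k : ℕ) (hk : K < k) : (A * P).meas k = ∅ := by
  simp [mul_def, hA k hk, hP k hk]

theorem Adapted.word_mul {B : Pauli n} {A P : C.Label} {K j : ℕ} (hK : K ≤ l)
    (hA : Adapted B A K j) (hP : Adapted 1 P K j) :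
    word B A l * word 1 P l = word B (A * P) l := by
  rw [word_eq_of_meas_eq_empty hA.meas_eq_empty hK, word_eq_of_meas_eq_empty hP.meas_eq_empty hK,
    word_eq_of_meas_eq_empty (mul_meas_eq_empty hA.meas_eq_empty hP.meas_eq_empty) hK,
    Label.word_mul hK le_rfl hP.commute_trunc]

theorem Adapted.mul {B : Pauli n} {A P : C.Label} {K j : ℕ} (hK : K ≤ l)
    (hA : Adapted B A K j) (hP : Adapted 1 P K j) : Adapted B (A * P) K j where
  meas_eq_empty := mul_meas_eq_empty hA.meas_eq_empty hP.meas_eq_empty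
  commute_trunc k hk i := by
    rw [← Label.word_mul hK hk.le hP.commute_trunc]
    exact (hA.commute_trunc k hk i).mul_left (hP.commute_trunc k hk i)
  commute_word i hi := by
    rw [← hA.word_mul hK hP]
    exact (hA.commute_word i hi).mul_left (hP.commute_word i hi)

theorem Adapted.succ {B : Pauli n} {A : C.Label} {K : ℕ} {i : Fin (C.numMeas (K + 1))}
    (hA : Adapted B A K i) (hi : Commute (word B A l) (C.meas (K + 1) i)) :
    Adapted B A K (i + 1) where
  meas_eq_empty := hA.meas_eq_empty
  commute_trunc := hA.commute_trunc
  commute_word i' hi' := by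
    rcases Nat.lt_succ_iff_lt_or_eq.1 hi' with h | h
    · exact hA.commute_word i' h
    · rwa [Fin.ext h]

/-- The word has no factor after round `K`, so its truncation there is the whole word, which
commutes with all of round `K + 1`. -/
theorem Adapted.next_round {B : Pauli n} {A : C.Label} {K : ℕ} (hK : K < l)
    (hA : Adapted B A K (C.numMeas (K + 1))) : Adapted B A (K + 1) 0 where
  meas_eq_empty k hk := hA.meas_eq_empty k (by omega)
  commute_trunc k hk i := by
    rcases Nat.lt_succ_iff_lt_or_eq.1 hk with h | rfl
    · exact hA.commute_trunc k h i
    · rw [← word_eq_of_meas_eq_empty hA.meas_eq_empty hK.le]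
      exact hA.commute_word i i.2
  commute_word i hi := by omega

theorem single_meas_of_ne {k k' : ℕ} (j : Fin (C.numMeas k)) (h : k' ≠ k) :
    (single C k j).meas k' = ∅ := by
  simp [single, h]

theorem word_single_of_lt {k N : ℕ} (j : Fin (C.numMeas k)) (h : N < k) :
    word 1 (single C k j) N = 1 := by
  induction N with
  | zero => simp [single]
  | succ N ih => rw [word_succ, ih (by omega), single_meas_of_ne j (by omega)]; simp

theorem word_single {K : ℕ} (j : Fin (C.numMeas (K + 1))) (hK : K < l) :
    word 1 (single C (K + 1) j) l = C.meas (K + 1) j := by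
  rw [word_eq_of_meas_eq_empty (K := K + 1) (fun k hk => single_meas_of_ne j (by omega)) hK,
    word_succ, word_single_of_lt j (by omega)]
  simp [single]

/-- All truncations before round `K + 1` are trivial. Level `K` itself is impossible, since the
label has a factor in round `K + 1`. -/
theorem adapted_single {K : ℕ} (j : Fin (C.numMeas (K + 1))) :
    Adapted 1 (single C (K + 1) j) (K + 1) 0 where
  meas_eq_empty k hk := single_meas_of_ne j (by omega)
  commute_trunc k hk i := by
    rw [word_single_of_lt j hk]
    exact Commute.one_left _
  commute_word i hi := by omega

theorem prod_symmDiff {ι : Type*} [DecidableEq ι] (f : ι → ℤˣ) (s t : Finset ι) :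
    ∏ i ∈ symmDiff s t, f i = (∏ i ∈ s, f i) * ∏ i ∈ t, f i := by
  rw [symmDiff, Finset.sup_eq_union, Finset.prod_union disjoint_sdiff_sdiff,
    ← Finset.prod_inter_mul_prod_sdiff s t, ← Finset.prod_inter_mul_prod_sdiff t s,
    Finset.inter_comm t s, mul_mul_mul_comm, Int.units_mul_self, one_mul]

theorem char_mul (f₀ : Fin C.numStab → ℤˣ) (f : C.Signs) (A P : C.Label) :
    char f₀ f (A * P) = char f₀ f A * char f₀ f P := by
  simp only [char, mul_def, prod_symmDiff, Finset.prod_mul_distrib]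
  rw [mul_mul_mul_comm]

theorem char_single (f₀ : Fin C.numStab → ℤˣ) (f : C.Signs) {K : ℕ}
    (j : Fin (C.numMeas (K + 1))) (hK : K < l) :
    char f₀ f (single C (K + 1) j) = f (K + 1) j := by
  rw [char, Finset.prod_eq_single (K + 1)]
  · simp [single]
  · intro k _ hk
    rw [single_meas_of_ne j hk, Finset.prod_empty]
  · intro h
    simp at h
    omega

theorem signedWord_one (B : Pauli n) (A : C.Label) :
    signedWord (fun _ _ => 1) B A = word B A l := by
  simp [signedWord, char, Pauli.ofSign_one]

theorem Adapted.signedWord_mul {B : Pauli n} {A P : C.Label} {K j : ℕ} (hK : K ≤ l)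
    (hA : Adapted B A K j) (hP : Adapted 1 P K j) (ε : C.Signs) :
    signedWord ε B A * signedWord ε 1 P = signedWord ε B (A * P) := by
  simp only [signedWord, char_mul, Pauli.ofSign_mul, ← hA.word_mul hK hP]
  rw [mul_assoc, ← mul_assoc (word B A l), ← (Pauli.ofSign_commute _ (word B A l)).eq]
  simp only [mul_assoc]

theorem signedWord_single (ε : C.Signs) {K : ℕ} (j : Fin (C.numMeas (K + 1))) (hK : K < l) :
    signedWord ε 1 (single C (K + 1) j) = Pauli.ofSign (ε (K + 1) j) * C.meas (K + 1) j := by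
  rw [signedWord, char_single _ _ _ hK, word_single j hK]

theorem commute_signedWord_iff (ε : C.Signs) (B : Pauli n) (A : C.Label) (q : Pauli n) :
    Commute (signedWord ε B A) q ↔ Commute (word B A l) q :=
  Pauli.commute_ofSign_mul_left _ _ _

theorem symp_word (e B : Pauli n) (A : C.Label) (N : ℕ) :
    Pauli.symp e (word B A N) = Pauli.symp e B + ∑ j ∈ A.stab, Pauli.symp e (C.stab j) +
      ∑ k ∈ Finset.Icc 1 N, ∑ j ∈ A.meas k, Pauli.symp e (C.meas k j) := by
  induction N with
  | zero => simp [Pauli.symp_mul_right, Pauli.symp_subsetProd]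
  | succ N ih =>
    rw [word_succ, Pauli.symp_mul_right, ih, Pauli.symp_subsetProd,
      Finset.sum_Icc_succ_top (by omega)]
    ring

end Label

end DynamicalCode

/-! ### The update rules on labels -/

namespace DynamicalCode

open Label

variable {n l : ℕ} {C : DynamicalCode n l}

/-- For every choice of signs, `T` consists of the operators named by `Λ` and `μ`, where `j`
measurements of round `K + 1` have been made. -/
structure IsNamed (L₀ : Pauli n) (T : C.Signs → Tracked n) (K j : ℕ) (Λ : List C.Label)
    (μ : C.Label) : Prop where
  gens : ∀ ε, (T ε).gens = Λ.map (signedWord ε 1)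
  logical : ∀ ε, (T ε).logical = signedWord ε L₀ μ
  adapted : ∀ A ∈ Λ, (∃ i, A = single C (K + 1) i) ∨ Adapted 1 A K j
  commute : ∀ A ∈ Λ, ∀ A' ∈ Λ, Commute (word 1 A l) (word 1 A' l)
  adapted_logical : Adapted L₀ μ K j

/-- `φ` has the outcomes for the operators named by `Λ` and `μ` that result from the values `v`,
`f₀`, `f` of `L₀`, the initial generators and the measurements. -/
structure HasValues (L₀ : Pauli n) (v : ℤˣ) (f₀ : Fin C.numStab → ℤˣ) (f : C.Signs)
    (Λ : List C.Label) (μ : C.Label) (φ : QState n) : Prop where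
  gens : ∀ A ∈ Λ, Pauli.Fixes (word 1 A l) (char f₀ f A) φ
  logical : Pauli.Fixes (word L₀ μ l) (v * char f₀ f μ) φ

section Step

variable {L₀ : Pauli n} {T : C.Signs → Tracked n} {K : ℕ} {Λ : List C.Label} {μ : C.Label}

theorem IsNamed.disturbs_iff {j : ℕ} (h : IsNamed L₀ T K j Λ μ) (ε : C.Signs) (m : Pauli n) :
    (T ε).Disturbs m ↔ ∃ A ∈ Λ, ¬ Commute (word 1 A l) m := by
  simp [Tracked.Disturbs, h.gens, commute_signedWord_iff]

/-- For the two recordings the generators differ only by signs; hence the first case of the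
stabilizer rule is selected independently of the recording. -/
theorem IsNamed.mem_closure_imp {j : ℕ} (h : IsNamed L₀ T K j Λ μ) (ε ε' : C.Signs)
    (m : Pauli n)
    (hm : ∃ η : ℤˣ, Pauli.ofSign η * m ∈ Subgroup.closure {s | s ∈ (T ε).gens}) :
    ∃ η : ℤˣ, Pauli.ofSign η * m ∈ Subgroup.closure {s | s ∈ (T ε').gens} := by
  obtain ⟨η, hη⟩ := hm
  have key : ∀ s ∈ {s | s ∈ (T ε).gens},
      ∃ η : ℤˣ, Pauli.ofSign η * s ∈ Subgroup.closure {s | s ∈ (T ε').gens} := by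
    intro s hs
    simp only [Set.mem_ofPred_eq, h.gens, List.mem_map] at hs
    obtain ⟨A, hA, rfl⟩ := hs
    refine ⟨char (fun _ => 1) ε' A * char (fun _ => 1) ε A, Subgroup.subset_closure ?_⟩
    simp only [Set.mem_ofPred_eq, h.gens, List.mem_map]
    refine ⟨A, hA, ?_⟩
    rw [signedWord, signedWord, ← mul_assoc, ← Pauli.ofSign_mul, mul_assoc, Int.units_mul_self,
      mul_one]
  obtain ⟨η', hη'⟩ := Pauli.ofSign_mul_mem_closure key hη
  exact ⟨η' * η, by rwa [Pauli.ofSign_mul, mul_assoc]⟩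

/-- The generators commute with each other, so each of them centralizes the group they generate. The
first two cases of the stabilizer rule therefore exclude each other. -/
theorem IsNamed.not_disturbs {j : ℕ} (h : IsNamed L₀ T K j Λ μ) (ε : C.Signs) {m : Pauli n}
    (hm : ∃ η : ℤˣ, Pauli.ofSign η * m ∈ Subgroup.closure {s | s ∈ (T ε).gens}) :
    ¬ (T ε).Disturbs m := by
  rw [h.disturbs_iff]
  rintro ⟨A, hA, hAm⟩
  obtain ⟨η, hη⟩ := hm
  apply hAm
  have hle : Subgroup.closure {s | s ∈ (T ε).gens} ≤ Subgroup.centralizer {word 1 A l} := by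
    rw [Subgroup.closure_le]
    intro s hs
    simp only [Set.mem_ofPred_eq, h.gens, List.mem_map] at hs
    obtain ⟨A', hA', rfl⟩ := hs
    rw [SetLike.mem_coe, Subgroup.mem_centralizer_singleton_iff]
    exact (commute_signedWord_iff _ _ _ _).2 (h.commute A' hA' A hA)
  have := hle hη
  rw [Subgroup.mem_centralizer_singleton_iff] at this
  exact ((Pauli.commute_ofSign_mul_left _ _ _).1 this).symm

theorem HasValues.fixes_mul {v : ℤˣ} {f₀ : Fin C.numStab → ℤˣ} {f : C.Signs} {φ : QState n}
    {B : Pauli n} {A P : C.Label} {w : ℤˣ} {j : ℕ} (hK : K ≤ l)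
    (h : HasValues L₀ v f₀ f Λ μ φ) (hB : Pauli.Fixes (word B A l) (w * char f₀ f A) φ)
    (hP : P ∈ Λ) (hA : Adapted B A K j) (hPa : Adapted 1 P K j) :
    Pauli.Fixes (word B (A * P) l) (w * char f₀ f (A * P)) φ := by
  rw [← hA.word_mul hK hPa, char_mul, ← mul_assoc]
  exact hB.mul (h.gens P hP)

/-- One measurement. -/
theorem IsNamed.update (hK : K < l) (i : Fin (C.numMeas (K + 1)))
    (h : IsNamed L₀ T K i Λ μ) (q : ℕ)
    (hq : (T fun _ _ => 1).Disturbs (C.meas (K + 1) i) →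
      ∃ hlt : q < (T fun _ _ => 1).gens.length,
        ¬ Commute ((T fun _ _ => 1).gens[q]) (C.meas (K + 1) i))
    (hl : ¬ Commute (C.meas (K + 1) i) (T fun _ _ => 1).logical →
      (T fun _ _ => 1).Disturbs (C.meas (K + 1) i)) :
    ∃ Λ' μ', IsNamed L₀ (fun ε => (T ε).update (C.meas (K + 1) i) (ε (K + 1) i) q) K (i + 1)
        Λ' μ' ∧
      ∀ v f₀ f φ, HasValues L₀ v f₀ f Λ μ φ →
        HasValues L₀ v f₀ f Λ' μ' ((C.meas (K + 1) i).measure (f (K + 1) i) φ) := by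
  classical
  set m := C.meas (K + 1) i
  have hKl : K ≤ l := hK.le
  have hround : ∀ i', Commute (C.meas (K + 1) i') m := fun i' =>
    C.meas_commute _ (by omega) (by omega) _ _
  have hsingle : word 1 (single C (K + 1) i) l = m := word_single i hK
  have hmφ : ∀ f₀ (f : C.Signs) φ, Pauli.Fixes (word 1 (single C (K + 1) i) l)
      (char f₀ f (single C (K + 1) i)) (m.measure (f (K + 1) i) φ) := by
    intro f₀ f φ
    rw [hsingle, char_single _ _ i hK]
    exact Pauli.fixes_measure_self (C.meas_observable _ (by omega) (by omega) _) _ _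
  by_cases hD : ∃ A ∈ Λ, ¬ Commute (word 1 A l) m
  · have hDε : ∀ ε, (T ε).Disturbs m := fun ε => (h.disturbs_iff ε m).2 hD
    obtain ⟨hlt, hqm⟩ := hq (hDε _)
    simp only [h.gens, List.length_map] at hlt
    have hget : ∀ ε, (T ε).gens.getD q 1 = signedWord ε 1 Λ[q] := by
      intro ε
      rw [h.gens, List.getD_eq_getElem _ _ (by simpa using hlt), List.getElem_map]
    have hP : Λ[q] ∈ Λ := List.getElem_mem _
    have hPm : ¬ Commute (word 1 Λ[q] l) m := by
      simpa [h.gens, signedWord_one] using hqm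
    -- An operator measured earlier in this round commutes with `m`; whatever anticommutes with `m`
    -- stems from earlier rounds and may be multiplied in normal form.
    have hgood : ∀ A ∈ Λ, ¬ Commute (word 1 A l) m → Adapted 1 A K i := by
      intro A hA hAm
      rcases h.adapted A hA with ⟨i', rfl⟩ | hA'
      · rw [word_single i' hK] at hAm
        exact absurd (hround i') hAm
      · exact hA'
    generalize Λ[q] = P at hget hP hPm
    have hPa := hgood P hP hPm
    -- The common rule for generators (`B = 1`) and for the logical (`B = L₀`): multiply by the
    -- pivot exactly when the word anticommutes with `m`.
    let g : Pauli n → C.Label → C.Label := fun B A =>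
      if Commute (word B A l) m then A else A * P
    have hgm : ∀ B A, (¬ Commute (word B A l) m → Adapted B A K i) →
        Commute (word B (g B A) l) m := by
      intro B A hA
      by_cases hc : Commute (word B A l) m
      · simp [g, hc]
      · simp only [g, hc, if_false, ← (hA hc).word_mul hKl hPa]
        exact Pauli.commute_mul_of_not_commute hc hPm
    have hga : ∀ B A, Adapted B A K i → Adapted B (g B A) K (i + 1) := by
      intro B A hA
      refine Adapted.succ ?_ (hgm B A fun _ => hA)
      by_cases hc : Commute (word B A l) m
      · simpa [g, hc] using hA
      · simpa [g, hc] using hA.mul hKl hPa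
    have hgφ : ∀ v f₀ f φ, HasValues L₀ v f₀ f Λ μ φ → ∀ B A w,
        (¬ Commute (word B A l) m → Adapted B A K i) →
        Pauli.Fixes (word B A l) (w * char f₀ f A) φ →
        Pauli.Fixes (word B (g B A) l) (w * char f₀ f (g B A)) (m.measure (f (K + 1) i) φ) := by
      intro v f₀ f φ hv B A w hA hφ
      refine Pauli.Fixes.measure ?_ (hgm B A hA) _
      by_cases hc : Commute (word B A l) m
      · simpa [g, hc] using hφ
      · simpa [g, hc] using hv.fixes_mul hKl hφ hP (hA hc) hPa
    have hgw : ∀ ε B A, (¬ Commute (word B A l) m → Adapted B A K i) →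
        signedWord ε B (g B A) = if Commute (signedWord ε B A) m then signedWord ε B A
          else signedWord ε B A * signedWord ε 1 P := by
      intro ε B A hA
      simp only [commute_signedWord_iff]
      by_cases hc : Commute (word B A l) m
      · simp [g, hc]
      · simp only [g, hc, if_false, (hA hc).signedWord_mul hKl hPa]
    have hmem : ∀ A' ∈ (Λ.map (g 1)).set q (single C (K + 1) i),
        A' = single C (K + 1) i ∨ ∃ A ∈ Λ, g 1 A = A' := by
      intro A' hA'
      rcases List.mem_or_eq_of_mem_set hA' with h1 | h1
      · exact Or.inr (List.mem_map.1 h1)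
      · exact Or.inl h1
    -- An updated generator is a product of old ones; applied in both arguments, this keeps the
    -- updated generators commuting.
    have hwc : ∀ A ∈ Λ, ∀ x, (∀ A ∈ Λ, Commute (word 1 A l) x) →
        Commute (word 1 (g 1 A) l) x := by
      intro A hA x hx
      by_cases hc : Commute (word 1 A l) m
      · simpa [g, hc] using hx A hA
      · simp only [g, hc, if_false, ← (hgood A hA hc).word_mul hKl hPa]
        exact (hx A hA).mul_left (hx P hP)
    refine ⟨(Λ.map (g 1)).set q (single C (K + 1) i), g L₀ μ, ⟨?_, ?_, ?_, ?_, ?_⟩, ?_⟩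
    · intro ε
      change Tracked.updateGens m (ε (K + 1) i) q (T ε) = _
      rw [Tracked.updateGens, if_neg fun hQ => h.not_disturbs ε hQ (hDε ε), if_pos (hDε ε), hget,
        h.gens, List.map_set, List.map_map, List.map_map, signedWord_single ε i hK]
      congr 1
      refine List.map_congr_left fun A hA => ?_
      exact (hgw ε 1 A (hgood A hA)).symm
    · intro ε
      change Tracked.updateLogical m (ε (K + 1) i) q (T ε) = _
      rw [Tracked.updateLogical, if_pos (hDε ε), hget, h.logical,
        hgw ε L₀ μ fun _ => h.adapted_logical]
      simp only [Commute.symm_iff (a := m)]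
    · intro A' hA'
      rcases hmem A' hA' with rfl | ⟨A, hA, rfl⟩
      · exact Or.inl ⟨i, rfl⟩
      · rcases h.adapted A hA with ⟨i', rfl⟩ | hAa
        · have : Commute (word 1 (single C (K + 1) i') l) m := by
            rw [word_single i' hK]
            exact hround i'
          exact Or.inl ⟨i', by simp [g, this]⟩
        · exact Or.inr (hga 1 A hAa)
    · intro A₁ h₁ A₂ h₂
      rcases hmem A₁ h₁ with rfl | ⟨A₁, hA₁, rfl⟩ <;> rcases hmem A₂ h₂ with rfl | ⟨A₂, hA₂, rfl⟩
      · exact Commute.refl _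
      · rw [hsingle]
        exact (hgm 1 A₂ (hgood A₂ hA₂)).symm
      · rw [hsingle]
        exact hgm 1 A₁ (hgood A₁ hA₁)
      · exact hwc A₁ hA₁ _ fun A hA => (hwc A₂ hA₂ _ fun A' hA' => h.commute A' hA' A hA).symm
    · exact hga L₀ μ h.adapted_logical
    · intro v f₀ f φ hv
      refine ⟨?_, hgφ v f₀ f φ hv L₀ μ v (fun _ => h.adapted_logical) hv.logical⟩
      intro A' hA'
      rcases hmem A' hA' with rfl | ⟨A, hA, rfl⟩
      · exact hmφ f₀ f φ
      · have := hgφ v f₀ f φ hv 1 A 1 (hgood A hA) (by simpa using hv.gens A hA)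
        simpa using this
  · have hDε : ∀ ε, ¬ (T ε).Disturbs m := fun ε => by rwa [h.disturbs_iff ε m]
    -- No generator anticommutes with `m`, so an anticommuting logical would be measured out,
    -- against `hl`.
    have hLm : Commute (word L₀ μ l) m := by
      by_contra hc
      refine hDε _ (hl fun hc' => hc ?_)
      rw [h.logical, signedWord_one] at hc'
      exact hc'.symm
    have hlog : ∀ ε, Tracked.updateLogical m (ε (K + 1) i) q (T ε) = signedWord ε L₀ μ := by
      intro ε
      rw [Tracked.updateLogical, h.logical,
        if_pos ((commute_signedWord_iff ε L₀ μ m).2 hLm).symm]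
    push Not at hD
    have hold : ∀ A ∈ Λ, (∃ i, A = single C (K + 1) i) ∨ Adapted 1 A K (i + 1) := fun A hA =>
      (h.adapted A hA).imp id fun hAa => hAa.succ (hD A hA)
    by_cases hQ : ∃ η : ℤˣ,
        Pauli.ofSign η * m ∈ Subgroup.closure {s | s ∈ (T fun _ _ => 1).gens}
    · refine ⟨Λ, μ, ⟨?_, hlog, hold, h.commute, h.adapted_logical.succ hLm⟩, ?_⟩
      · intro ε
        change Tracked.updateGens m (ε (K + 1) i) q (T ε) = _
        rw [Tracked.updateGens, if_pos (h.mem_closure_imp _ ε m hQ), h.gens]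
      · exact fun v f₀ f φ hv => ⟨fun A hA => (hv.gens A hA).measure (hD A hA) _,
          hv.logical.measure hLm _⟩
    · refine ⟨Λ ++ [single C (K + 1) i], μ, ⟨?_, hlog, ?_, ?_, h.adapted_logical.succ hLm⟩, ?_⟩
      · intro ε
        change Tracked.updateGens m (ε (K + 1) i) q (T ε) = _
        rw [Tracked.updateGens, if_neg fun hQ' => hQ (h.mem_closure_imp ε _ m hQ'),
          if_neg (hDε ε), h.gens, List.map_append, List.map_singleton, signedWord_single ε i hK]
      · intro A hA
        rcases List.mem_append.1 hA with hA | hA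
        · exact hold A hA
        · exact Or.inl ⟨i, List.mem_singleton.1 hA⟩
      · intro A₁ h₁ A₂ h₂
        rcases List.mem_append.1 h₁ with h₁ | h₁ <;> rcases List.mem_append.1 h₂ with h₂ | h₂
        · exact h.commute _ h₁ _ h₂
        · rw [List.mem_singleton.1 h₂, hsingle]
          exact hD A₁ h₁
        · rw [List.mem_singleton.1 h₁, hsingle]
          exact (hD A₂ h₂).symm
        · rw [List.mem_singleton.1 h₁, List.mem_singleton.1 h₂]
      · intro v f₀ f φ hv
        refine ⟨fun A hA => ?_, hv.logical.measure hLm _⟩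
        rcases List.mem_append.1 hA with hA | hA
        · exact (hv.gens A hA).measure (hD A hA) _
        · rw [List.mem_singleton.1 hA]
          exact hmφ f₀ f φ

/-- Part of a round. -/
theorem IsNamed.trackPartial (hK : K < l) (h : IsNamed L₀ T K 0 Λ μ) (p : C.Pivots)
    (hp : ∀ j : Fin (C.numMeas (K + 1)),
      (C.trackPartial p (fun _ _ => 1) (K + 1) (T fun _ _ => 1) j).Disturbs (C.meas (K + 1) j) →
      ∃ hlt : p (K + 1) j <
          (C.trackPartial p (fun _ _ => 1) (K + 1) (T fun _ _ => 1) j).gens.length,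
        ¬ Commute ((C.trackPartial p (fun _ _ => 1) (K + 1) (T fun _ _ => 1) j).gens[p (K + 1) j])
          (C.meas (K + 1) j))
    (hl : ∀ j : Fin (C.numMeas (K + 1)), ¬ Commute (C.meas (K + 1) j)
        (C.trackPartial p (fun _ _ => 1) (K + 1) (T fun _ _ => 1) j).logical →
      (C.trackPartial p (fun _ _ => 1) (K + 1) (T fun _ _ => 1) j).Disturbs (C.meas (K + 1) j))
    (j : ℕ) (hj : j ≤ C.numMeas (K + 1)) :
    ∃ Λ' μ', IsNamed L₀ (fun ε => C.trackPartial p ε (K + 1) (T ε) j) K j Λ' μ' ∧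
      ∀ v f₀ f φ, HasValues L₀ v f₀ f Λ μ φ → HasValues L₀ v f₀ f Λ' μ'
        (((List.finRange (C.numMeas (K + 1))).take j).foldl
          (fun φ j => (C.meas (K + 1) j).measure (f (K + 1) j) φ) φ) := by
  induction j with
  | zero => exact ⟨Λ, μ, by simpa [DynamicalCode.trackPartial] using h, by simp⟩
  | succ j ih =>
    obtain ⟨Λ₁, μ₁, h₁, hv₁⟩ := ih (by omega)
    obtain ⟨Λ₂, μ₂, h₂, hv₂⟩ := h₁.update hK ⟨j, hj⟩ (p (K + 1) ⟨j, hj⟩) (hp ⟨j, hj⟩) (hl ⟨j, hj⟩)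
    have htake : (List.finRange (C.numMeas (K + 1))).take (j + 1) =
        (List.finRange (C.numMeas (K + 1))).take j ++ [⟨j, hj⟩] := by
      rw [List.take_succ_eq_append_getElem (by simpa using hj)]
      simp
    refine ⟨Λ₂, μ₂, ?_, ?_⟩
    · convert h₂ using 2 with ε
      simp only [DynamicalCode.trackPartial, htake, List.foldl_append, List.foldl_cons,
        List.foldl_nil]
    · intro v f₀ f φ hv
      rw [htake, List.foldl_append]
      exact hv₂ v f₀ f _ (hv₁ v f₀ f φ hv)

/-- Only when the round is closed do its own measurements become adapted labels, available as pivots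
of later rounds. -/
theorem IsNamed.next_round (hK : K < l) (h : IsNamed L₀ T K (C.numMeas (K + 1)) Λ μ) :
    IsNamed L₀ T (K + 1) 0 Λ μ where
  gens := h.gens
  logical := h.logical
  adapted A hA := by
    rcases h.adapted A hA with ⟨i, rfl⟩ | hAa
    · exact Or.inr (adapted_single i)
    · exact Or.inr (hAa.next_round hK)
  commute := h.commute
  adapted_logical := h.adapted_logical.next_round hK

end Step

/-! ### Accumulated errors and the values along a run -/

theorem netError_succ_of_le {e : ℕ → Pauli n} {K k : ℕ} (hk : k ≤ K + 1) :
    netError (K + 1) e k = e (K + 1) * netError K e k := by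
  simp only [netError]
  rw [show K + 1 + 1 - k = (K + 1 - k) + 1 by omega, List.range'_concat, List.map_append,
    List.reverse_append, show k + 1 * (K + 1 - k) = K + 1 by omega]
  simp

theorem netError_of_lt {e : ℕ → Pauli n} {K k : ℕ} (hk : K < k) : netError K e k = 1 := by
  simp [netError, show K + 1 - k = 0 by omega]

/-- The values after the errors up to round `K` for the initial generators. -/
def stabValue (a : Fin C.numStab → ℤˣ) (e : ℕ → Pauli n) (K : ℕ) (j : Fin C.numStab) : ℤˣ :=
  a j * (-1) ^ Pauli.symp (netError K e 0) (C.stab j)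

/-- The values after the errors up to round `K` for the measured operators. -/
def measValue (o : C.Signs) (e : ℕ → Pauli n) (K : ℕ) : C.Signs := fun k j =>
  o k j * (-1) ^ Pauli.symp (netError K e k) (C.meas k j)

theorem char_values (a : Fin C.numStab → ℤˣ) (o : C.Signs) (e : ℕ → Pauli n) (K : ℕ)
    (A : C.Label) :
    char (stabValue a e K) (measValue o e K) A = char a o A *
      (-1) ^ (∑ j ∈ A.stab, Pauli.symp (netError K e 0) (C.stab j) +
        ∑ k ∈ Finset.Icc 1 l, ∑ j ∈ A.meas k, Pauli.symp (netError K e k) (C.meas k j)) := by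
  simp only [char, stabValue, measValue, Finset.prod_mul_distrib, uzpow_add,
    Pauli.neg_one_uzpow_sum]
  rw [mul_mul_mul_comm]

/-- The new error flips the whole word by its symplectic product with it. By additivity this equals
extending the net error of every factor by `e (K + 1)`. -/
theorem char_values_succ (a : Fin C.numStab → ℤˣ) (o : C.Signs) (e : ℕ → Pauli n) {K : ℕ}
    (B : Pauli n) (v : ℤˣ) {A : C.Label} (hA : ∀ k, K + 1 < k → A.meas k = ∅) :
    v * (-1) ^ Pauli.symp (netError (K + 1) e 0) B *
        char (stabValue a e (K + 1)) (measValue o e (K + 1)) A =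
      v * (-1) ^ Pauli.symp (netError K e 0) B * char (stabValue a e K) (measValue o e K) A *
        (-1) ^ Pauli.symp (e (K + 1)) (word B A l) := by
  have hsum : ∑ k ∈ Finset.Icc 1 l,
        ∑ j ∈ A.meas k, Pauli.symp (netError (K + 1) e k) (C.meas k j) =
      ∑ k ∈ Finset.Icc 1 l, (∑ j ∈ A.meas k, Pauli.symp (e (K + 1)) (C.meas k j) +
        ∑ j ∈ A.meas k, Pauli.symp (netError K e k) (C.meas k j)) := by
    refine Finset.sum_congr rfl fun k _ => ?_
    -- For later rounds both net errors are empty and do not satisfy the recursion, but `A` has no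
    -- factors there.
    by_cases hk : K + 1 < k
    · simp [hA k hk]
    · simp [netError_succ_of_le (not_lt.1 hk), Pauli.symp_mul_left, Finset.sum_add_distrib]
  rw [char_values, char_values, hsum, netError_succ_of_le (Nat.zero_le _), symp_word]
  simp only [Pauli.symp_mul_left, Finset.sum_add_distrib, uzpow_add]
  ac_rfl

/-- The operators tracked after round `K`, with their values in every run of the code. -/
theorem exists_isNamed_track (C : DynamicalCode n l) (L₀ : Pauli n) (p : C.Pivots)
    (hp : C.ValidPivots L₀ p (fun _ _ => 1)) (hlog : C.PreservesLogical L₀ p (fun _ _ => 1))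
    (K : ℕ) (hK : K ≤ l) :
    ∃ Λ μ, IsNamed L₀ (fun ε => C.track L₀ p ε K) K 0 Λ μ ∧ (∀ k, K - 1 < k → μ.meas k = ∅) ∧
      ∀ (ψ : QState n) (v : ℤˣ) (a : Fin C.numStab → ℤˣ) (o : C.Signs) (e : ℕ → Pauli n),
        Pauli.Fixes L₀ v ψ → (∀ j, Pauli.Fixes (C.stab j) (a j) ψ) →
        HasValues L₀ (v * (-1) ^ Pauli.symp (netError K e 0) L₀) (stabValue a e K)
          (measValue o e K) Λ μ (C.stateAfter o e ψ K) := by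
  induction K with
  | zero =>
    have hw : ∀ (B : Pauli n) (S : Finset (Fin C.numStab)),
        word B (⟨S, fun _ => ∅⟩ : C.Label) l = B * Pauli.subsetProd C.stab S := by
      intro B S
      rw [word_eq_of_meas_eq_empty (K := 0) (fun _ _ => rfl) (Nat.zero_le _), word_zero]
    have hs : ∀ ε B (S : Finset (Fin C.numStab)),
        signedWord ε B (⟨S, fun _ => ∅⟩ : C.Label) = B * Pauli.subsetProd C.stab S := by
      intro ε B S
      simp [signedWord, hw, char, Pauli.ofSign_one]
    have ha : ∀ B (S : Finset (Fin C.numStab)),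
        Adapted B (⟨S, fun _ => ∅⟩ : C.Label) 0 0 := fun B S =>
      ⟨fun _ _ => rfl, by simp, by simp⟩
    have he : ∀ e : ℕ → Pauli n, netError 0 e 0 = e 0 := by simp [netError]
    refine ⟨List.ofFn fun j => ⟨{j}, fun _ => ∅⟩, ⟨∅, fun _ => ∅⟩,
      ⟨?_, ?_, ?_, ?_, ha _ _⟩, fun _ _ => rfl, ?_⟩
    · intro ε
      simp [track, List.map_ofFn, Function.comp_def, hs]
    · intro ε
      simp [track, hs]
    · intro A hA
      obtain ⟨j, rfl⟩ := (List.mem_ofFn' _ _).1 hA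
      exact Or.inr (ha _ _)
    · intro A hA A' hA'
      obtain ⟨j, rfl⟩ := (List.mem_ofFn' _ _).1 hA
      obtain ⟨j', rfl⟩ := (List.mem_ofFn' _ _).1 hA'
      simp [hw, C.stab_commute]
    · intro ψ v a o e hL hS
      refine ⟨fun A hA => ?_, ?_⟩
      · obtain ⟨j, rfl⟩ := (List.mem_ofFn' _ _).1 hA
        simpa [hw, char, stabValue, stateAfter, he] using (hS j).error (e 0)
      · simpa [hw, char, stateAfter, he] using hL.error (e 0)
  | succ K ih =>
    obtain ⟨Λ, μ, h, -, hv⟩ := ih (by omega)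
    obtain ⟨Λ', μ', h', hv'⟩ := h.trackPartial (by omega) p (hp K (by omega))
      (hlog K (by omega)) _ le_rfl
    have h'' := h'.next_round (by omega)
    -- The support bound comes from `h'`, before the round is closed: the logical has no factor
    -- measured in round `K + 1`.
    refine ⟨Λ', μ', h'', h'.adapted_logical.meas_eq_empty, ?_⟩
    intro ψ v a o e hL hS
    -- No error has yet occurred after the measurements of round `K + 1`, so their values are the
    -- bare outcomes.
    have hfold : ((List.finRange (C.numMeas (K + 1))).take (C.numMeas (K + 1))).foldl
          (fun φ j => (C.meas (K + 1) j).measure (measValue o e K (K + 1) j) φ)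
          (C.stateAfter o e ψ K) =
        (List.finRange (C.numMeas (K + 1))).foldl
          (fun φ j => (C.meas (K + 1) j).measure (o (K + 1) j) φ) (C.stateAfter o e ψ K) := by
      rw [List.take_of_length_le (by simp)]
      simp [measValue, netError_of_lt]
    have hval := hv' _ _ _ _ (hv ψ v a o e hL hS)
    rw [hfold] at hval
    have hsupp : ∀ A ∈ Λ', ∀ k, K + 1 < k → A.meas k = ∅ := by
      intro A hA
      rcases h'.adapted A hA with ⟨i, rfl⟩ | hAa
      · exact (adapted_single i).meas_eq_empty
      · exact fun k hk => hAa.meas_eq_empty k (by omega)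
    refine ⟨fun A hA => ?_, ?_⟩
    · have := (hval.gens A hA).error (e (K + 1))
      have hc := char_values_succ a o e 1 1 (hsupp A hA)
      simp only [Pauli.symp_one_right, uzpow_zero, one_mul] at hc
      rw [hc]
      exact this
    · rw [char_values_succ a o e L₀ v h''.adapted_logical.meas_eq_empty]
      exact hval.logical.error (e (K + 1))

end DynamicalCode

theorem mainTheorem10 {n l : ℕ} (C : DynamicalCode n l) (L₀ : Pauli n)
    (hL₀ : L₀.IsObservable) (hL₀S : ∀ j, Commute L₀ (C.stab j)) (p : C.Pivots)
    (hp : C.ValidPivots L₀ p (fun _ _ => 1)) (hlog : C.PreservesLogical L₀ p (fun _ _ => 1)) :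
    ∃ (A₀ : Finset (Fin C.numStab)) (A : (k : ℕ) → Finset (Fin (C.numMeas k))),
      let s₀ : Pauli n := Pauli.subsetProd C.stab A₀
      let m : ℕ → Pauli n := fun k => Pauli.subsetProd (C.meas k) (A k)
      -- the final logical representative
      (∀ ε : C.Signs, (C.track L₀ p ε l).logical =
        Pauli.ofSign (∏ k ∈ Finset.Icc 1 (l - 1), ∏ j ∈ A k, ε k j) *
          (L₀ * s₀ * ((List.range' 1 (l - 1)).map m).prod)) ∧
      -- its outcome, in every run of the code that has nonzero probability
      ∀ (ψ : QState n) (OL₀ : ℤˣ) (a : Fin C.numStab → ℤˣ) (o : C.Signs) (e : ℕ → Pauli n),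
        Pauli.HasOutcome L₀ OL₀ ψ → (∀ j, Pauli.HasOutcome (C.stab j) (a j) ψ) →
        C.stateAfter o e ψ l ≠ 0 →
        Pauli.HasOutcome (C.track L₀ p (fun _ _ => 1) l).logical
          (OL₀ * (-1) ^ Pauli.symp L₀ (netError l e 0) *
            (∏ k ∈ Finset.Icc 1 (l - 1), ∏ j ∈ A k, o k j) * (∏ j ∈ A₀, a j) *
            (-1) ^ Pauli.symp (netError l e 0) s₀ *
            (-1) ^ ∑ k ∈ Finset.Icc 1 (l - 1), Pauli.symp (netError l e k) (m k))
          (C.stateAfter o e ψ l) := by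
  obtain ⟨Λ, μ, h, hμ, hv⟩ := C.exists_isNamed_track L₀ p hp hlog l le_rfl
  have hsub : Finset.Icc 1 (l - 1) ⊆ Finset.Icc 1 l :=
    Finset.Icc_subset_Icc_right (Nat.sub_le _ _)
  -- The only such `k` is `l`; for `l = 0` there is none.
  have hempty : ∀ k ∈ Finset.Icc 1 l, k ∉ Finset.Icc 1 (l - 1) → μ.meas k = ∅ := by
    intro k hk hk'
    simp only [Finset.mem_Icc] at hk hk'
    exact hμ k (by omega)
  have hchar : ∀ f₀ f, DynamicalCode.Label.char f₀ f μ =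
      (∏ j ∈ μ.stab, f₀ j) * ∏ k ∈ Finset.Icc 1 (l - 1), ∏ j ∈ μ.meas k, f k j := by
    intro f₀ f
    rw [DynamicalCode.Label.char, Finset.prod_subset hsub fun k hk hk' => by
      rw [hempty k hk hk', Finset.prod_empty]]
  -- The witnesses come from one label fixed before signs, states, outcomes and errors are
  -- introduced. Nonvanishing of the final state enters only here, since `Pauli.Fixes` allows zero.
  refine ⟨μ.stab, μ.meas, fun ε => ?_, fun ψ v a o e hL hS hne => ⟨hne, ?_⟩⟩
  · rw [h.logical ε, DynamicalCode.Label.signedWord, hchar,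
      DynamicalCode.Label.word_eq_of_meas_eq_empty hμ (Nat.sub_le _ _)]
    simp [DynamicalCode.Label.word]
  · have := (hv ψ v a o e hL.2 fun j => (hS j).2).logical
    rw [h.logical, DynamicalCode.Label.signedWord_one]
    refine Eq.trans this ?_
    congr 3
    rw [DynamicalCode.char_values, hchar, Pauli.symp_comm L₀, Pauli.symp_subsetProd,
      ← Finset.sum_subset hsub fun k hk hk' => by rw [hempty k hk hk', Finset.sum_empty]]
    simp only [Pauli.symp_subsetProd, uzpow_add]
    ac_rfl
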